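/- Let $\mathbf{P}$ be a nonempty set of propositional variables. The formulas of the logic of essence and accident ($\mathrm{LEA}$-formulas) are given by $\phi ::= p \mid \neg\phi \mid (\phi\wedge\phi) \mid \circ\phi$ with $p\in\mathbf{P}$. A model is a triple $\mathcal{M}=\langle S,R,V\rangle$ with $S$ a nonempty set, $R\subseteq S\times S$ and $V:\mathbf{P}\to\mathcal{P}(S)$. Truth at a pointed model $(\mathcal{M},s)$, $s\in S$, is defined as usual for propositional variables, $\neg$ and $\wedge$, and $$\mathcal{M},s\vDash\circ\phi \iff \bigl(\mathcal{M},s\vDash\phi \ \Rightarrow\ \mathcal{M},t\vDash\phi \text{ for all } t \text{ with } sRt\bigr).$$ A nonempty relation $Z\subseteq S\times S$ is a $\circ$-bisimulation on $\mathcal{M}$ if $sZs'$ implies: (Inv) for all $p\in\mathbf{P}$, $s\in V(p)$ iff $s'\in V(p)$; ($\circ$-Forth) if $sRt$ and $(s,t)\notin Z$, then there is $t'$ with $s'Rt'$ and $tZt'$; ($\circ$-Back) if $s'Rt'$ and $(s',t')\notin Z$, then there is $t$ with $sRt$ and $tZt'$. Pointed models $(\mathcal{M},s)$ and $(\mathcal{N},t)$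 are $\circ$-bisimilar if there is a $\circ$-bisimulation $Z$ on the disjoint union of $\mathcal{M}$ and $\mathcal{N}$ with $sZt$. Consider the first-order language with equality that has a unary predicate symbol for each $p\in\mathbf{P}$ and one further, binary predicate symbol. A model $\mathcal{M}$ is a structure for this language by interpreting them as $V(p)$ and $R$. For a formula $\alpha(x)$ with at most one free variable $x$, write $\mathcal{M},s\vDash\alpha$ if $\alpha$ is true in $\mathcal{M}$ when $x$ is assigned $s$. Say that $\alpha$ is equivalent to an $\mathrm{LEA}$-formula $\phi$ if $\mathcal{M},s\vDash\alpha \Leftrightarrow \mathcal{M},s\vDash\phi$ for all pointed models $(\mathcal{M},s)$, and that $\alpha$ is invariant under $\circ$-bisimulation if $\mathcal{M},s\vDash\alpha \Leftrightarrow \mathcal{N},t\vDash\alpha$ whenever $(\mathcal{M},s)$ and $(\mathcal{N},t)$ are $\circ$-bisimilar. **Theorem.** A first-order formula $\alpha(x)$ of this language is equivalent to an $\mathrm{LEA}$-formula if and only if it is invariant under $\circ$-bisimulation. -/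

import Mathlib

universe u v

namespace EssenceLogic

/-- Formulas of the logic of essence and accident over a set `BP` of propositional variables:
`φ ::= p | ¬φ | (φ ∧ φ) | ∘φ`. -/
inductive LEA (BP : Type u) : Type u
  | atom (p : BP) : LEA BP
  | neg (φ : LEA BP) : LEA BP
  | and (φ ψ : LEA BP) : LEA BP
  | circ (φ : LEA BP) : LEA BP

/-- A frame: a nonempty set of worlds with an arbitrary binary relation. -/
structure Frame : Type (v + 1) where
  World : Type v
  nonempty : Nonempty World
  rel : World → World → Prop

/-- A model: a frame with a valuation of the propositional variables. -/
structure Model (BP : Type u) extends Frame.{v} where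
  val : BP → Set World

variable {BP : Type u}

/-- Truth of an `LEA`-formula at a pointed model. -/
def Sat (M : Model.{u, v} BP) : M.World → LEA BP → Prop
  | s, .atom p => s ∈ M.val p
  | s, .neg φ => ¬ Sat M s φ
  | s, .and φ ψ => Sat M s φ ∧ Sat M s ψ
  | s, .circ φ => Sat M s φ → ∀ t, M.rel s t → Sat M t φ

/-- The disjoint union of two models. -/
def disjointUnion (M N : Model.{u, v} BP) : Model.{u, v} BP where
  World := M.World ⊕ N.World
  nonempty := M.nonempty.map Sum.inl
  rel
    | .inl s, .inl t => M.rel s t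
    | .inr s, .inr t => N.rel s t
    | _, _ => False
  val p := {x | Sum.elim (fun s => s ∈ M.val p) (fun s => s ∈ N.val p) x}

/-- `Z` is a `∘`-bisimulation on the model `M`. -/
structure IsCircBisimulation (M : Model.{u, v} BP) (Z : M.World → M.World → Prop) : Prop where
  nonempty : ∃ s s', Z s s'
  inv : ∀ s s', Z s s' → ∀ p, s ∈ M.val p ↔ s' ∈ M.val p
  forth : ∀ s s', Z s s' → ∀ t, M.rel s t → ¬ Z s t → ∃ t', M.rel s' t' ∧ Z t t'
  back : ∀ s s', Z s s' → ∀ t', M.rel s' t' → ¬ Z s' t' → ∃ t, M.rel s t ∧ Z t t'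

/-- `(M, s)` and `(N, t)` are `∘`-bisimilar: some `∘`-bisimulation on the disjoint union of
`M` and `N` relates `s` to `t`. -/
def CircBisimilar (M : Model.{u, v} BP) (s : M.World) (N : Model.{u, v} BP) (t : N.World) :
    Prop :=
  ∃ Z : (disjointUnion M N).World → (disjointUnion M N).World → Prop,
    IsCircBisimulation (disjointUnion M N) Z ∧ Z (Sum.inl s) (Sum.inr t)

/-- Relation symbols of the first-order correspondence language: a unary predicate for each
propositional variable and one binary predicate for the accessibility relation. -/
inductive CorrRel (BP : Type u) : ℕ → Type u
  | pred (p : BP) : CorrRel BP 1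
  | acc : CorrRel BP 2

/-- The first-order correspondence language (equality is a logical symbol). -/
def corrLang (BP : Type u) : FirstOrder.Language.{0, u} where
  Functions := fun _ => Empty
  Relations := CorrRel BP

/-- A model as a first-order structure for the correspondence language. -/
instance (M : Model.{u, v} BP) : (corrLang BP).Structure M.World where
  funMap := fun f _ => Empty.elim f
  RelMap := fun {n} (r : CorrRel BP n) =>
    match n, r with
    | _, .pred p => fun xs => xs 0 ∈ M.val p
    | _, .acc => fun xs => M.rel (xs 0) (xs 1)

/-- First-order formulas `α(x)` of the correspondence language, in (at most) one free variable. -/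
abbrev FOFormula (BP : Type u) : Type u := (corrLang BP).Formula Unit

/-- `M, s ⊨ α`: the formula `α(x)` is true in `M` when `x` is assigned the world `s`. -/
def FOSat (M : Model.{u, v} BP) (s : M.World) (α : FOFormula BP) : Prop :=
  α.Realize (fun _ => s)

/-- `α` and `φ` are equivalent: they are true at the same pointed models. -/
def Equivalent (α : FOFormula BP) (φ : LEA BP) : Prop :=
  ∀ (M : Model.{u, v} BP) (s : M.World), FOSat M s α ↔ Sat M s φ

/-- `α` is invariant under `∘`-bisimulation. -/
def CircInvariant (α : FOFormula BP) : Prop :=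
  ∀ (M : Model.{u, v} BP) (s : M.World) (N : Model.{u, v} BP) (t : N.World),
    CircBisimilar M s N t → (FOSat M s α ↔ FOSat N t α)

end EssenceLogic

/-!
The proof of the nontrivial direction avoids the compactness theorem: both models needed in the
van Benthem argument are obtained at once as ultraproducts over `ℕ`.

A first-order formula `α` mentions only finitely many propositional variables, so it does not
change its truth value when all other variables are emptied (`exists_finite_fOSat_restrict`). Hence
only the countably many `LEA`-formulas over a finite set `Q` of variables matter
(`LEA.countable_over`); let `e 0, e 1, …` enumerate them. If `α` is equivalent to no
`LEA`-formula, then for every `n` the formula `α` is not a Boolean combination of the formulas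
`e k`, `k < n` (`exists_lea_of_determined`), so there are pointed models that agree on these
formulas while `α` holds at the first and fails at the second. The ultraproducts of the two
sequences of pointed models along a nonprincipal ultrafilter on `ℕ` agree on every formula over `Q`,
while Łoś's theorem says that they still disagree on `α`.

Ultraproducts of this kind are `ω`-saturated; what is needed of this is that a sequence of
`LEA`-formulas is satisfied at one successor of a world as soon as each initial segment of it is
(`saturated_ultraproduct`). On a model with this property the relation of satisfying the same
formulas over `Q` is a `∘`-bisimulation (`isCircBisimulation_leaEquiv`): the assumption `(s, t) ∉ Z`
of the forth condition provides a formula `φ` true at `s` and false at `t`, and for any `γ` true at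
`t` the formula `∘¬(¬φ ∧ γ)` is then false at `s`, hence at `s'`, which gives `s'` a successor
satisfying `γ`. So an invariant `α` could not distinguish the two ultraproducts.
-/

open Filter FirstOrder

namespace EssenceLogic

/-! ### Invariance of `LEA`-formulas under `∘`-bisimulation -/

@[simp]
theorem sat_disjointUnion_inl (M N : Model.{u, v} BP) (s : M.World) (φ : LEA BP) :
    Sat (disjointUnion M N) (Sum.inl s) φ ↔ Sat M s φ := by
  induction φ generalizing s with
  | atom p => exact Iff.rfl
  | neg φ ih => exact not_congr (ih s)
  | and φ ψ ih₁ ih₂ => exact and_congr (ih₁ s) (ih₂ s)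
  | circ φ ih =>
    refine imp_congr (ih s) ⟨fun h t ht => (ih t).1 (h (Sum.inl t) ht), ?_⟩
    rintro h (t | t) ht
    · exact (ih t).2 (h t ht)
    · exact ht.elim

@[simp]
theorem sat_disjointUnion_inr (M N : Model.{u, v} BP) (s : N.World) (φ : LEA BP) :
    Sat (disjointUnion M N) (Sum.inr s) φ ↔ Sat N s φ := by
  induction φ generalizing s with
  | atom p => exact Iff.rfl
  | neg φ ih => exact not_congr (ih s)
  | and φ ψ ih₁ ih₂ => exact and_congr (ih₁ s) (ih₂ s)
  | circ φ ih =>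
    refine imp_congr (ih s) ⟨fun h t ht => (ih t).1 (h (Sum.inr t) ht), ?_⟩
    rintro h (t | t) ht
    · exact ht.elim
    · exact (ih t).2 (h t ht)

theorem IsCircBisimulation.sat_iff {M : Model.{u, v} BP} {Z : M.World → M.World → Prop}
    (hZ : IsCircBisimulation M Z) (φ : LEA BP) {s s' : M.World} (h : Z s s') :
    Sat M s φ ↔ Sat M s' φ := by
  induction φ generalizing s s' with
  | atom p => exact hZ.inv s s' h p
  | neg φ ih => exact not_congr (ih h)
  | and φ ψ ih₁ ih₂ => exact and_congr (ih₁ h) (ih₂ h)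
  | circ φ ih =>
    -- If `Z` relates a world to its own successor, the premise `φ` is passed on directly.
    constructor
    · intro hs hφ t' ht'
      by_cases hZt : Z s' t'
      · exact (ih hZt).1 hφ
      · obtain ⟨t, ht, htt⟩ := hZ.back s s' h t' ht' hZt
        exact (ih htt).1 (hs ((ih h).2 hφ) t ht)
    · intro hs hφ t ht
      by_cases hZt : Z s t
      · exact (ih hZt).1 hφ
      · obtain ⟨t', ht', htt⟩ := hZ.forth s s' h t ht hZt
        exact (ih htt).2 (hs ((ih h).1 hφ) t' ht')

theorem CircBisimilar.sat_iff {M N : Model.{u, v} BP} {s : M.World} {t : N.World}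
    (h : CircBisimilar M s N t) (φ : LEA BP) : Sat M s φ ↔ Sat N t φ := by
  obtain ⟨Z, hZ, hst⟩ := h
  simpa using hZ.sat_iff φ hst

/-! ### Formulas over a set of propositional variables -/

/-- `φ.Over Q`: every propositional variable occurring in `φ` belongs to `Q`. -/
def LEA.Over (Q : Set BP) : LEA BP → Prop
  | .atom p => p ∈ Q
  | .neg φ => φ.Over Q
  | .and φ ψ => φ.Over Q ∧ ψ.Over Q
  | .circ φ => φ.Over Q

/-- A numerical code of a formula, built from codes `f p` of the propositional variables. -/
def LEA.code (f : BP → ℕ) : LEA BP → ℕ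
  | .atom p => Nat.pair 0 (f p)
  | .neg φ => Nat.pair 1 (φ.code f)
  | .and φ ψ => Nat.pair 2 (Nat.pair (φ.code f) (ψ.code f))
  | .circ φ => Nat.pair 3 (φ.code f)

theorem LEA.code_injOn {f : BP → ℕ} {Q : Set BP} (hf : Set.InjOn f Q) :
    Set.InjOn (LEA.code f) {φ | φ.Over Q} := by
  intro φ
  induction φ with
  | atom p =>
    rintro hp (q | _ | ⟨_, _⟩ | _) hq h <;> simp [LEA.code] at h
    rw [hf hp hq h]
  | neg φ ih =>
    rintro hφ (_ | ψ | ⟨_, _⟩ | _) hψ h <;> simp [LEA.code] at h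
    rw [ih (x₂ := ψ) hφ hψ h]
  | and φ φ' ih ih' =>
    rintro hφ (_ | _ | ⟨ψ, ψ'⟩ | _) hψ h <;> simp [LEA.code] at h
    rw [ih hφ.1 hψ.1 h.1, ih' hφ.2 hψ.2 h.2]
  | circ φ ih =>
    rintro hφ (_ | _ | ⟨_, _⟩ | ψ) hψ h <;> simp [LEA.code] at h
    rw [ih (x₂ := ψ) hφ hψ h]

theorem LEA.countable_over {Q : Set BP} (hQ : Q.Countable) : {φ : LEA BP | φ.Over Q}.Countable := by
  obtain ⟨f, hf⟩ := Set.countable_iff_exists_injOn.1 hQ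
  exact Set.countable_iff_exists_injOn.2 ⟨_, LEA.code_injOn hf⟩

theorem LEA.exists_enumeration {Q : Set BP} (hQ : Q.Countable) (hne : Q.Nonempty) :
    ∃ e : ℕ → LEA BP, ∀ φ : LEA BP, φ.Over Q ↔ ∃ k, e k = φ := by
  obtain ⟨p, hp⟩ := hne
  obtain ⟨e, he⟩ := (LEA.countable_over hQ).exists_eq_range ⟨.atom p, hp⟩
  exact ⟨e, fun φ => Set.ext_iff.1 he φ⟩

/-- The model in which all propositional variables outside `Q` are false everywhere. -/
def Model.restrict (M : Model.{u, v} BP) (Q : Set BP) : Model.{u, v} BP where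
  toFrame := M.toFrame
  val p := {s | p ∈ Q ∧ s ∈ M.val p}

theorem sat_restrict (M : Model.{u, v} BP) {Q : Set BP} {φ : LEA BP} (hφ : φ.Over Q)
    (s : M.World) : Sat (M.restrict Q) s φ ↔ Sat M s φ := by
  induction φ generalizing s with
  | atom p => exact and_iff_right hφ
  | neg φ ih => exact not_congr (ih hφ s)
  | and φ ψ ih₁ ih₂ => exact and_congr (ih₁ hφ.1 s) (ih₂ hφ.2 s)
  | circ φ ih =>
    exact imp_congr (ih hφ s) (forall_congr' fun t => imp_congr Iff.rfl (ih hφ t))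

theorem term_realize_restrict (M : Model.{u, v} BP) (Q : Set BP) {β : Type*}
    (t : (corrLang BP).Term β) (x : β → M.World) :
    t.realize (M := (M.restrict Q).World) x = t.realize (M := M.World) x := by
  cases t with
  | var i => rfl
  | func f _ => exact Empty.elim f

theorem exists_finite_realize_restrict {β : Type*} {n : ℕ}
    (α : (corrLang BP).BoundedFormula β n) :
    ∃ Q₀ : Set BP, Q₀.Finite ∧ ∀ Q, Q₀ ⊆ Q → ∀ (M : Model.{u, v} BP) (x : β → M.World)
      (y : Fin n → M.World),
      α.Realize (M := (M.restrict Q).World) x y ↔ α.Realize (M := M.World) x y := by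
  induction α with
  | falsum => exact ⟨∅, Set.finite_empty, fun _ _ _ _ _ => Iff.rfl⟩
  | equal t₁ t₂ =>
    refine ⟨∅, Set.finite_empty, fun Q _ M x y => ?_⟩
    exact Eq.congr (term_realize_restrict M Q t₁ _) (term_realize_restrict M Q t₂ _)
  | rel r ts =>
    cases r with
    | pred p =>
      refine ⟨{p}, Set.finite_singleton p, fun Q hQ M x y => ?_⟩
      exact (and_iff_right (hQ rfl)).trans
        (iff_of_eq (congrArg (· ∈ M.val p) (term_realize_restrict M Q (ts 0) _)))
    | acc =>
      refine ⟨∅, Set.finite_empty, fun Q _ M x y => ?_⟩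
      exact iff_of_eq (congrArg₂ M.rel (term_realize_restrict M Q (ts 0) _)
        (term_realize_restrict M Q (ts 1) _))
  | imp _ _ ih₁ ih₂ =>
    obtain ⟨Q₁, hf₁, h₁⟩ := ih₁
    obtain ⟨Q₂, hf₂, h₂⟩ := ih₂
    exact ⟨Q₁ ∪ Q₂, hf₁.union hf₂, fun Q hQ M x y =>
      imp_congr (h₁ Q (Set.subset_union_left.trans hQ) M x y)
        (h₂ Q (Set.subset_union_right.trans hQ) M x y)⟩
  | all _ ih =>
    obtain ⟨Q₀, hf, h⟩ := ih
    exact ⟨Q₀, hf, fun Q hQ M x y => forall_congr' fun a => h Q hQ M x (Fin.snoc y a)⟩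

theorem exists_finite_fOSat_restrict (α : FOFormula BP) :
    ∃ Q₀ : Set BP, Q₀.Finite ∧ ∀ Q, Q₀ ⊆ Q → ∀ (M : Model.{u, v} BP) (s : M.World),
      FOSat (M.restrict Q) s α ↔ FOSat M s α := by
  obtain ⟨Q₀, hf, h⟩ := exists_finite_realize_restrict.{u, v} α
  exact ⟨Q₀, hf, fun Q hQ M s => h Q hQ M _ _⟩

/-! ### Boolean combinations -/

/-- A property of pointed models that depends only on the truth values of finitely many
`LEA`-formulas is defined by an `LEA`-formula. -/
theorem exists_lea_of_determined [Nonempty BP] (e : ℕ → LEA BP) (n : ℕ)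
    (P : ∀ M : Model.{u, v} BP, M.World → Prop)
    (hP : ∀ (M N : Model.{u, v} BP) (s : M.World) (t : N.World),
      (∀ k < n, Sat M s (e k) ↔ Sat N t (e k)) → P M s → P N t) :
    ∃ φ : LEA BP, ∀ (M : Model.{u, v} BP) (s : M.World), P M s ↔ Sat M s φ := by
  induction n generalizing P with
  | zero =>
    let p := LEA.atom (Classical.arbitrary BP)
    by_cases h : ∃ (M : Model.{u, v} BP) (s : M.World), P M s
    · obtain ⟨M, s, hs⟩ := h
      refine ⟨.neg (.and p (.neg p)), fun N t => ⟨fun _ => ?_, fun _ => ?_⟩⟩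
      · simp [Sat]
      · exact hP M N s t (by simp) hs
    · push Not at h
      refine ⟨.and p (.neg p), fun N t => ⟨fun ht => (h N t ht).elim, fun ht => ?_⟩⟩
      exact (ht.2 ht.1).elim
  | succ n ih =>
    -- `R b` holds where `P` would hold if `e n` had truth value `b`.
    let R (b : Prop) (M : Model.{u, v} BP) (s : M.World) : Prop :=
      ∃ (N : Model.{u, v} BP) (t : N.World),
        (∀ k < n, Sat M s (e k) ↔ Sat N t (e k)) ∧ (Sat N t (e n) ↔ b) ∧ P N t
    have key (b : Prop) : ∃ φ : LEA BP, ∀ (M : Model.{u, v} BP) (s : M.World),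
        R b M s ↔ Sat M s φ := by
      refine ih (R b) ?_
      rintro M N s t hst ⟨N', t', h, hn, hP'⟩
      exact ⟨N', t', fun k hk => (hst k hk).symm.trans (h k hk), hn, hP'⟩
    have hR (b : Prop) (M : Model.{u, v} BP) (s : M.World) (hb : Sat M s (e n) ↔ b) :
        P M s ↔ R b M s := by
      constructor
      · exact fun h => ⟨M, s, fun _ _ => Iff.rfl, hb, h⟩
      · rintro ⟨N, t, h, hn, hPt⟩
        refine hP N M t s (fun k hk => ?_) hPt
        rcases Nat.lt_succ_iff_lt_or_eq.1 hk with hk | rfl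
        · exact (h k hk).symm
        · exact hn.trans hb.symm
    obtain ⟨φ₁, h₁⟩ := key True
    obtain ⟨φ₀, h₀⟩ := key False
    -- The formula `(e n → φ₁) ∧ (¬ e n → φ₀)`.
    refine ⟨.and (.neg (.and (e n) (.neg φ₁))) (.neg (.and (.neg (e n)) (.neg φ₀))),
      fun M s => ?_⟩
    simp only [Sat, ← h₁, ← h₀]
    by_cases hn : Sat M s (e n)
    · rw [hR True M s (by simp [hn])]
      simp [hn]
    · rw [hR False M s (by simp [hn])]
      simp [hn]

/-! ### Saturated models -/

/-- A model is saturated if a sequence of `LEA`-formulas is satisfied at a single successor of a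
world whenever each of its initial segments is. -/
def Saturated (M : Model.{u, v} BP) : Prop :=
  ∀ (s : M.World) (γ : ℕ → LEA BP),
    (∀ n, ∃ t, M.rel s t ∧ ∀ k < n, Sat M t (γ k)) → ∃ t, M.rel s t ∧ ∀ k, Sat M t (γ k)

theorem Saturated.disjointUnion {M N : Model.{u, v} BP} (hM : Saturated M) (hN : Saturated N) :
    Saturated (disjointUnion M N) := by
  rintro (s | s) γ h
  · obtain ⟨t, hst, ht⟩ := hM s γ fun n => by
      obtain ⟨t | t, hst, ht⟩ := h n
      · exact ⟨t, hst, fun k hk => (sat_disjointUnion_inl M N t _).1 (ht k hk)⟩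
      · exact hst.elim
    exact ⟨Sum.inl t, hst, fun k => (sat_disjointUnion_inl M N t _).2 (ht k)⟩
  · obtain ⟨t, hst, ht⟩ := hN s γ fun n => by
      obtain ⟨t | t, hst, ht⟩ := h n
      · exact hst.elim
      · exact ⟨t, hst, fun k hk => (sat_disjointUnion_inr M N t _).1 (ht k hk)⟩
    exact ⟨Sum.inr t, hst, fun k => (sat_disjointUnion_inr M N t _).2 (ht k)⟩

/-- The conjunction of `φ` with the first `n` formulas of the sequence `γ`. -/
def LEA.conj (φ : LEA BP) (γ : ℕ → LEA BP) : ℕ → LEA BP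
  | 0 => φ
  | n + 1 => .and (LEA.conj φ γ n) (γ n)

theorem sat_conj (M : Model.{u, v} BP) (s : M.World) (φ : LEA BP) (γ : ℕ → LEA BP) (n : ℕ) :
    Sat M s (φ.conj γ n) ↔ Sat M s φ ∧ ∀ k < n, Sat M s (γ k) := by
  induction n with
  | zero => simp [LEA.conj]
  | succ n ih => simp only [LEA.conj, Sat, ih, Nat.forall_lt_succ_right, and_assoc]

theorem LEA.Over.conj {Q : Set BP} {φ : LEA BP} (hφ : φ.Over Q) {γ : ℕ → LEA BP}
    (hγ : ∀ k, (γ k).Over Q) (n : ℕ) : (φ.conj γ n).Over Q := by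
  induction n with
  | zero => exact hφ
  | succ n ih => exact ⟨ih, hγ n⟩

/-- Two worlds satisfy the same formulas over `Q`. -/
def LEAEquiv (Q : Set BP) (M : Model.{u, v} BP) (s s' : M.World) : Prop :=
  ∀ φ : LEA BP, φ.Over Q → (Sat M s φ ↔ Sat M s' φ)

theorem LEAEquiv.symm {Q : Set BP} {M : Model.{u, v} BP} {s s' : M.World}
    (h : LEAEquiv Q M s s') : LEAEquiv Q M s' s :=
  fun φ hφ => (h φ hφ).symm

theorem Saturated.exists_leaEquiv {Q : Set BP} (hQ : Q.Countable) (hne : Q.Nonempty)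
    {M : Model.{u, v} BP} (hM : Saturated M) {s s' t : M.World} (h : LEAEquiv Q M s s')
    (hst : M.rel s t) (hnot : ¬ LEAEquiv Q M s t) : ∃ t', M.rel s' t' ∧ LEAEquiv Q M t t' := by
  classical
  obtain ⟨e, he⟩ := LEA.exists_enumeration hQ hne
  have heQ (k : ℕ) : (e k).Over Q := (he _).2 ⟨k, rfl⟩
  obtain ⟨φ, hφ, hs, ht⟩ : ∃ φ : LEA BP, φ.Over Q ∧ Sat M s φ ∧ ¬ Sat M t φ := by
    simp only [LEAEquiv, not_forall] at hnot
    obtain ⟨φ, hφ, hne⟩ := hnot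
    by_cases hs : Sat M s φ
    · exact ⟨φ, hφ, hs, fun ht => hne ⟨fun _ => ht, fun _ => hs⟩⟩
    · exact ⟨.neg φ, hφ, hs, fun ht => hne ⟨fun h => (hs h).elim, fun h => (ht h).elim⟩⟩
  -- The theory of `t` over `Q`.
  let γ (k : ℕ) : LEA BP := if Sat M t (e k) then e k else .neg (e k)
  have hγQ (k : ℕ) : (γ k).Over Q := by
    by_cases hk : Sat M t (e k)
    · simpa [γ, hk] using heQ k
    · simpa [γ, hk, LEA.Over] using heQ k
  have hγt (k : ℕ) : Sat M t (γ k) := by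
    by_cases hk : Sat M t (e k)
    · simp [γ, hk]
    · simp [γ, hk, Sat]
  obtain ⟨t', hst', ht'⟩ := hM s' γ fun n => by
    let χ : LEA BP := (LEA.neg φ).conj γ n
    have hχ : (LEA.circ (.neg χ)).Over Q := LEA.Over.conj (φ := .neg φ) hφ hγQ n
    have h₁ : ¬ Sat M s (.circ (.neg χ)) := fun hc =>
      hc (fun hsχ => ((sat_conj M s _ γ n).1 hsχ).1 hs) t hst
        ((sat_conj M t _ γ n).2 ⟨ht, fun k _ => hγt k⟩)
    rw [h _ hχ] at h₁
    simp only [Sat, not_forall, not_not] at h₁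
    obtain ⟨-, t', hst', ht'⟩ := h₁
    exact ⟨t', hst', ((sat_conj M t' _ γ n).1 ht').2⟩
  refine ⟨t', hst', fun ψ hψ => ?_⟩
  obtain ⟨k, rfl⟩ := (he ψ).1 hψ
  have := ht' k
  by_cases hk : Sat M t (e k)
  · simp only [γ, hk, if_true] at this
    exact ⟨fun _ => this, fun _ => hk⟩
  · simp only [γ, hk, if_false] at this
    exact ⟨fun h => (hk h).elim, fun h => (this h).elim⟩

theorem isCircBisimulation_leaEquiv {Q : Set BP} (hQ : Q.Countable) (hne : Q.Nonempty)
    {M : Model.{u, v} BP} (hM : Saturated M) (hval : ∀ p ∉ Q, M.val p = ∅) :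
    IsCircBisimulation M (LEAEquiv Q M) where
  nonempty := M.nonempty.elim fun s => ⟨s, s, fun _ _ => Iff.rfl⟩
  inv s s' h p := by
    by_cases hp : p ∈ Q
    · exact h (.atom p) hp
    · simp [hval p hp]
  forth _ _ h _ hst hnot := hM.exists_leaEquiv hQ hne h hst hnot
  back _ _ h _ hst hnot := by
    obtain ⟨t, ht, htt⟩ := hM.exists_leaEquiv hQ hne h.symm hst hnot
    exact ⟨t, ht, htt.symm⟩

/-- Among saturated models, agreement on the formulas over `Q` implies `∘`-bisimilarity. -/
theorem circBisimilar_of_saturated {Q : Set BP} (hQ : Q.Countable) (hne : Q.Nonempty)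
    {M N : Model.{u, v} BP} (hM : Saturated M) (hN : Saturated N)
    (hMval : ∀ p ∉ Q, M.val p = ∅) (hNval : ∀ p ∉ Q, N.val p = ∅) {s : M.World} {t : N.World}
    (h : ∀ φ : LEA BP, φ.Over Q → (Sat M s φ ↔ Sat N t φ)) : CircBisimilar M s N t := by
  refine ⟨LEAEquiv Q (disjointUnion M N),
    isCircBisimulation_leaEquiv hQ hne (hM.disjointUnion hN) fun p hp => ?_,
    fun φ hφ => by simpa using h φ hφ⟩
  refine Set.eq_empty_of_forall_notMem ?_
  rintro (s | s) hs
  · exact Set.eq_empty_iff_forall_notMem.1 (hMval p hp) s hs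
  · exact Set.eq_empty_iff_forall_notMem.1 (hNval p hp) s hs

/-! ### Ultraproducts of models -/

/-- The ultraproduct of a sequence of models: the first-order ultraproduct, read as a model. -/
def Model.ultraproduct (U : Ultrafilter ℕ) (M : ℕ → Model.{u, v} BP) : Model.{u, v} BP where
  World := (U : Filter ℕ).Product fun i => (M i).World
  nonempty :=
    haveI := fun i => (M i).nonempty
    Language.Ultraproduct.Product.instNonempty
  rel x y := Language.Structure.RelMap (L := corrLang BP) CorrRel.acc ![x, y]
  val p := {x | Language.Structure.RelMap (L := corrLang BP) (CorrRel.pred p) ![x]}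

/-- The world of the ultraproduct represented by a sequence of worlds. -/
def Model.mkWorld (U : Ultrafilter ℕ) {M : ℕ → Model.{u, v} BP} (x : ∀ i, (M i).World) :
    (Model.ultraproduct U M).World :=
  (x : (U : Filter ℕ).Product fun i => (M i).World)

theorem Model.exists_mkWorld (U : Ultrafilter ℕ) {M : ℕ → Model.{u, v} BP}
    (x : (Model.ultraproduct U M).World) : ∃ x', x = Model.mkWorld U x' := by
  induction x using Quotient.inductionOn' with
  | _ x' => exact ⟨x', rfl⟩

theorem ultraproduct_rel (U : Ultrafilter ℕ) {M : ℕ → Model.{u, v} BP} (x y : ∀ i, (M i).World) :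
    (Model.ultraproduct U M).rel (Model.mkWorld U x) (Model.mkWorld U y) ↔
      ∀ᶠ i in U, (M i).rel (x i) (y i) := by
  have h := Language.relMap_quotient_mk' (L := corrLang BP)
    (s := (U : Filter ℕ).productSetoid fun i => (M i).World) CorrRel.acc ![x, y]
  have hxy : (![Model.mkWorld U x, Model.mkWorld U y] : Fin 2 → (Model.ultraproduct U M).World) =
      fun i => Model.mkWorld U (![x, y] i) := by
    ext i
    fin_cases i <;> rfl
  exact Iff.trans (iff_of_eq (congrArg (Language.Structure.RelMap (L := corrLang BP)
    (M := (U : Filter ℕ).Product fun i => (M i).World) CorrRel.acc) hxy)) h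

theorem ultraproduct_val (U : Ultrafilter ℕ) {M : ℕ → Model.{u, v} BP} (x : ∀ i, (M i).World)
    (p : BP) : Model.mkWorld U x ∈ (Model.ultraproduct U M).val p ↔
      ∀ᶠ i in U, x i ∈ (M i).val p := by
  have h := Language.relMap_quotient_mk' (L := corrLang BP)
    (s := (U : Filter ℕ).productSetoid fun i => (M i).World) (CorrRel.pred p) ![x]
  have hx : (![Model.mkWorld U x] : Fin 1 → (Model.ultraproduct U M).World) =
      fun i => Model.mkWorld U (![x] i) := by
    ext i
    fin_cases i
    rfl
  exact Iff.trans (iff_of_eq (congrArg (Language.Structure.RelMap (L := corrLang BP)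
    (M := (U : Filter ℕ).Product fun i => (M i).World) (CorrRel.pred p)) hx)) h

/-- The ultraproduct, turned back into a first-order structure, is the ultraproduct of the
structures. -/
theorem structure_ultraproduct (U : Ultrafilter ℕ) (M : ℕ → Model.{u, v} BP) :
    (inferInstance : (corrLang BP).Structure (Model.ultraproduct U M).World) =
      Language.Ultraproduct.structure (M := fun i => (M i).World) (u := U) := by
  refine Language.Structure.ext (funext₃ fun _ f _ => Empty.elim f) (funext₃ fun n r x => ?_)
  cases r with
  | pred p =>
    refine congrArg _ ?_
    ext i
    fin_cases i
    rfl
  | acc =>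
    refine congrArg _ ?_
    ext i
    fin_cases i <;> rfl

/-- Łoś's theorem for first-order formulas in one variable. -/
theorem fOSat_ultraproduct (U : Ultrafilter ℕ) {M : ℕ → Model.{u, v} BP} (x : ∀ i, (M i).World)
    (α : FOFormula BP) :
    FOSat (Model.ultraproduct U M) (Model.mkWorld U x) α ↔ ∀ᶠ i in U, FOSat (M i) (x i) α := by
  have := fun i => (M i).nonempty
  refine Iff.trans (iff_of_eq ?_) (Language.Ultraproduct.realize_formula_cast α fun _ => x)
  exact congrArg (fun S : (corrLang BP).Structure (Model.ultraproduct U M).World =>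
    @Language.Formula.Realize (corrLang BP) _ S _ α fun _ => Model.mkWorld U x)
    (structure_ultraproduct U M)

/-- Łoś's theorem for `LEA`-formulas. -/
theorem sat_ultraproduct (U : Ultrafilter ℕ) {M : ℕ → Model.{u, v} BP} (x : ∀ i, (M i).World)
    (φ : LEA BP) :
    Sat (Model.ultraproduct U M) (Model.mkWorld U x) φ ↔ ∀ᶠ i in U, Sat (M i) (x i) φ := by
  induction φ generalizing x with
  | atom p => exact ultraproduct_val U x p
  | neg φ ih => simp only [Sat, ih, Ultrafilter.eventually_not]
  | and φ ψ ih₁ ih₂ => simp only [Sat, ih₁, ih₂, eventually_and]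
  | circ φ ih =>
    simp only [Sat, ih, Ultrafilter.eventually_imp]
    refine imp_congr_right fun _ => ⟨fun h => ?_, fun h t ht => ?_⟩
    · -- Choose, wherever possible, a successor refuting `φ`.
      have hy (i : ℕ) : ∃ y, ((M i).rel (x i) y → Sat (M i) y φ) →
          ∀ t, (M i).rel (x i) t → Sat (M i) t φ := by
        by_cases hc : ∀ t, (M i).rel (x i) t → Sat (M i) t φ
        · exact ⟨x i, fun _ => hc⟩
        · push Not at hc
          obtain ⟨y, hy, hyφ⟩ := hc
          exact ⟨y, fun hc => (hyφ (hc hy)).elim⟩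
      choose y hy using hy
      have := h (Model.mkWorld U y)
      rw [ultraproduct_rel, ih, ← Ultrafilter.eventually_imp] at this
      exact this.mono hy
    · obtain ⟨y, rfl⟩ := Model.exists_mkWorld U t
      rw [ultraproduct_rel] at ht
      rw [ih]
      filter_upwards [h, ht] with i hi hy using hi (y i) hy

theorem saturated_ultraproduct {U : Ultrafilter ℕ} (hU : (U : Filter ℕ) ≤ atTop)
    (M : ℕ → Model.{u, v} BP) : Saturated (Model.ultraproduct U M) := by
  intro s γ h
  obtain ⟨x, rfl⟩ := Model.exists_mkWorld U s
  let A (n i : ℕ) (y : (M i).World) : Prop := (M i).rel (x i) y ∧ ∀ k < n, Sat (M i) y (γ k)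
  have hA (n : ℕ) : ∀ᶠ i in U, ∃ y, A n i y := by
    obtain ⟨t, hst, ht⟩ := h n
    obtain ⟨y, rfl⟩ := Model.exists_mkWorld U t
    rw [ultraproduct_rel] at hst
    have : ∀ᶠ i in (U : Filter ℕ), ∀ k ∈ Finset.range n, Sat (M i) (y i) (γ k) :=
      (eventually_all_finset _).2 fun k hk =>
        (sat_ultraproduct U y _).1 (ht k (Finset.mem_range.1 hk))
    filter_upwards [hst, this] with i h₁ h₂
    exact ⟨y i, h₁, fun k hk => h₂ k (Finset.mem_range.2 hk)⟩
  -- In the `i`-th factor, satisfy as many of the first `i` formulas as possible. The bound `i` only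
  -- serves to make the maximum exist.
  have hy (i : ℕ) : ∃ y, ∀ n ≤ i, (∃ y', A n i y') → A n i y := by
    classical
    by_cases h₀ : ∃ y', A 0 i y'
    · obtain ⟨y, hy⟩ := Nat.findGreatest_spec (P := fun n => ∃ y', A n i y') (Nat.zero_le i) h₀
      refine ⟨y, fun n hn hex => ⟨hy.1, fun k hk => hy.2 k (hk.trans_le ?_)⟩⟩
      exact Nat.le_findGreatest hn hex
    · exact ⟨x i, fun n _ ⟨y', hy'⟩ => (h₀ ⟨y', hy'.1, by simp⟩).elim⟩
  choose y hy using hy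
  have hAy (n : ℕ) : ∀ᶠ i in U, A n i (y i) := by
    filter_upwards [hA n, hU (eventually_ge_atTop n)] with i h₁ h₂ using hy i n h₂ h₁
  refine ⟨Model.mkWorld U y, (ultraproduct_rel U x y).2 ((hAy 0).mono fun i hi => hi.1),
    fun k => (sat_ultraproduct U y _).2 ((hAy (k + 1)).mono fun i hi => hi.2 k (by simp))⟩

theorem ultraproduct_val_eq_empty (U : Ultrafilter ℕ) {M : ℕ → Model.{u, v} BP} {p : BP}
    (h : ∀ i, (M i).val p = ∅) : (Model.ultraproduct U M).val p = ∅ := by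
  refine Set.eq_empty_of_forall_notMem fun x hx => ?_
  obtain ⟨x, rfl⟩ := Model.exists_mkWorld U x
  rw [ultraproduct_val] at hx
  obtain ⟨i, hi⟩ := hx.exists
  exact Set.eq_empty_iff_forall_notMem.1 (h i) _ hi

/-! ### The characterization -/

/-- If `α` is not equivalent to an `LEA`-formula, it separates, for any finite part of a sequence of
formulas over `Q`, two pointed models that agree on it; these may be taken to make all variables
outside `Q` false. -/
theorem exists_separated [Nonempty BP] {α : FOFormula BP}
    (hα : ¬ ∃ φ : LEA BP, Equivalent.{u, v} α φ) {Q : Set BP}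
    (hQ : ∀ (M : Model.{u, v} BP) (s : M.World), FOSat (M.restrict Q) s α ↔ FOSat M s α)
    {e : ℕ → LEA BP} (he : ∀ k, (e k).Over Q) (n : ℕ) :
    ∃ (M N : Model.{u, v} BP) (s : M.World) (t : N.World),
      (∀ p ∉ Q, M.val p = ∅) ∧ (∀ p ∉ Q, N.val p = ∅) ∧
      (∀ k < n, Sat M s (e k) ↔ Sat N t (e k)) ∧ FOSat M s α ∧ ¬ FOSat N t α := by
  by_contra hcon
  refine hα (exists_lea_of_determined e n (fun M s => FOSat M s α) fun M N s t h hs => ?_)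
  by_contra ht
  refine hcon ⟨M.restrict Q, N.restrict Q, s, t, fun p hp => ?_, fun p hp => ?_, fun k hk => ?_,
    (hQ M s).2 hs, mt (hQ N t).1 ht⟩
  · exact Set.eq_empty_of_forall_notMem fun _ hx => hp hx.1
  · exact Set.eq_empty_of_forall_notMem fun _ hx => hp hx.1
  · exact (sat_restrict M (he k) s).trans ((h k hk).trans (sat_restrict N (he k) t).symm)

theorem exists_equivalent_of_circInvariant [Nonempty BP] {α : FOFormula BP}
    (hα : CircInvariant.{u, v} α) : ∃ φ : LEA BP, Equivalent.{u, v} α φ := by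
  by_contra hcon
  obtain ⟨Q₀, hfin, hQ₀⟩ := exists_finite_fOSat_restrict.{u, v} α
  -- A variable is added so that there are formulas over `Q` at all.
  let Q : Set BP := insert (Classical.arbitrary BP) Q₀
  have hQ : Q.Countable := (hfin.insert _).countable
  have hne : Q.Nonempty := Set.insert_nonempty _ _
  obtain ⟨e, he⟩ := LEA.exists_enumeration hQ hne
  have heQ (k : ℕ) : (e k).Over Q := (he _).2 ⟨k, rfl⟩
  choose M N s t hM hN hst hs ht using
    exists_separated hcon (hQ₀ Q (Set.subset_insert _ _)) heQ
  let U := hyperfilter ℕ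
  have hU : (U : Filter ℕ) ≤ atTop := Nat.hyperfilter_le_atTop
  have hsim : CircBisimilar (Model.ultraproduct U M) (Model.mkWorld U s)
      (Model.ultraproduct U N) (Model.mkWorld U t) := by
    refine circBisimilar_of_saturated hQ hne (saturated_ultraproduct hU M)
      (saturated_ultraproduct hU N) (fun p hp => ultraproduct_val_eq_empty U fun i => hM i p hp)
      (fun p hp => ultraproduct_val_eq_empty U fun i => hN i p hp) fun φ hφ => ?_
    obtain ⟨k, rfl⟩ := (he φ).1 hφ
    rw [sat_ultraproduct, sat_ultraproduct]
    refine eventually_congr ?_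
    filter_upwards [hU (eventually_gt_atTop k)] with n hn using hst n k hn
  have h := hα _ _ _ _ hsim
  rw [fOSat_ultraproduct, fOSat_ultraproduct] at h
  obtain ⟨n, hn⟩ := (h.1 (Eventually.of_forall hs)).exists
  exact ht n hn

end EssenceLogic

theorem mainTheorem2 {BP : Type u} [Nonempty BP] (α : EssenceLogic.FOFormula BP) :
    (∃ φ : EssenceLogic.LEA BP, EssenceLogic.Equivalent.{u, v} α φ) ↔
      EssenceLogic.CircInvariant.{u, v} α := by
  constructor
  · rintro ⟨φ, hφ⟩ M s N t hst
    exact (hφ M s).trans ((hst.sat_iff φ).trans (hφ N t).symm)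
  · exact EssenceLogic.exists_equivalent_of_circInvariant
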